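/- \textbf{Theorem (Equivalence of the norms).} All function classes are on $\mathbb{R}$ with Lebesgue measure, and functions are identified when they agree almost everywhere. For $f\in L^1_{loc}(\mathbb{R})$ put $$\|f\|_{BLO}=\sup_I\Big[\frac1{|I|}\int_I f\,dx-\inf_I f\Big],$$ where $I$ runs over the compact intervals of positive length and $\inf_I f$ is the essential infimum of $f$ over $I$; $f\in BLO$ means that $f\in L^1_{loc}(\mathbb{R})$ and $\|f\|_{BLO}<\infty$. For $g\in L^1_{loc}(\mathbb{R})$ let $Mg(x)=\sup_{I\ni x}\frac1{|I|}\int_I|g(t)|\,dt$ be the Hardy--Littlewood maximal function, where $I$ runs over the compact intervals of positive length containing $x$. Define $$\|f\|'_{BLO}=\inf\{\alpha+\|b\|_\infty:\ \alpha>0,\ b\in L^\infty(\mathbb{R}),\ f=\alpha\log(Mg)+b \text{ a.e. for some } g\in L^1_{loc}(\mathbb{R})\},$$ with $\inf\emptyset=\infty$. Then there are absolute constants $d_1,d_2>0$ such that, for every $f\in BLO$, $$d_1\|f\|_{BLO}\le\|f\|'_{BLO}\le d_2\|f\|_{BLO}.$$ -/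

import Mathlib

open MeasureTheory Set
open scoped ENNReal

noncomputable section

/-- The mean of `f` over `[a, b]` minus the essential infimum of `f` over `[a, b]`, for `a < b`.
The essential infimum is taken in the extended reals, so the value is `∞` when `f` is not
essentially bounded below on `[a, b]`; for locally integrable `f` the difference is never
negative, so `toENNReal` loses nothing. -/
def lowerOscillation (f : ℝ → ℝ) (a b : ℝ) : ℝ≥0∞ :=
  (((⨍ x in Icc a b, f x : ℝ) : EReal) -
    essInf (fun x : ℝ => (f x : EReal)) (volume.restrict (Icc a b))).toENNReal

/-- The usual `BLO` norm: the supremum of the lower oscillations over all compact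
(nondegenerate) intervals. -/
def bloNorm (f : ℝ → ℝ) : ℝ≥0∞ :=
  ⨆ (a : ℝ) (b : ℝ) (_ : a < b), lowerOscillation f a b

/-- Functions of bounded lower oscillation on the line. -/
def IsBLO (f : ℝ → ℝ) : Prop :=
  LocallyIntegrable f volume ∧ bloNorm f < ∞

/-- The (uncentred) Hardy-Littlewood maximal function: the supremum of the means of `|g|` over
all compact intervals containing `x`. -/
def hlMaximal (g : ℝ → ℝ) (x : ℝ) : ℝ≥0∞ :=
  ⨆ (a : ℝ) (b : ℝ) (_ : a < b) (_ : x ∈ Icc a b), ⨍⁻ t in Icc a b, ‖g t‖ₑ ∂volume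

/-- The decomposition `f = α log (M g) + b` almost everywhere, with `α > 0`, `g` locally
integrable and `b` essentially bounded. The logarithm is extended-real valued
(`log 0 = -∞`, `log ∞ = ∞`), so the identity includes that `0 < M g < ∞` almost everywhere. -/
def IsLogMaximalDecomposition (f : ℝ → ℝ) (α : ℝ) (g b : ℝ → ℝ) : Prop :=
  0 < α ∧ LocallyIntegrable g volume ∧ MemLp b ∞ volume ∧
    ∀ᵐ x : ℝ, (f x : EReal) = (α : EReal) * ENNReal.log (hlMaximal g x) + (b x : EReal)

/-- The new norm: the infimum of `α + ‖b‖_∞` over all decompositions `f = α log (M g) + b`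
(it is `∞` if there is none). -/
def bloNorm' (f : ℝ → ℝ) : ℝ≥0∞ :=
  ⨅ (α : ℝ) (g : ℝ → ℝ) (b : ℝ → ℝ) (_ : IsLogMaximalDecomposition f α g b),
    ENNReal.ofReal α + eLpNorm b ∞ volume

end

/-! For the upper bound, a small multiple of a BLO function is the logarithm of an A₁ weight. A
John–Nirenberg argument, measured from a lower bound m of f on the interval instead of its mean,
makes the superlevel sets decay geometrically (`volume_superlevel_le`). So, for N > 0 bounding the
BLO norm, w = exp(f / 60N) has mean at most 7 exp(m / 60N) on every interval
(`lintegral_exp_div_le`). Hence w ≤ Mw ≤ 14 w a.e., and f differs from 60N log(Mw) by a function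
bounded by a multiple of N.

For the lower bound, log(Mg) has lower oscillation bounded by an absolute constant. Let m be the
infimum of Mg on I. Intervals containing I have mean of |g| at most m, so intervals longer than I
contribute at most 2m to Mg on I; the others that meet I lie in the triple of I, where the weak type
estimate applies. The level sets {Mg > tm} in I therefore have measure O(|I|/t)
(`volume_lt_hlMaximal_inter_Icc_le`), and the mean of log(Mg/m) over I is bounded. A bounded summand
b adds at most 2‖b‖_∞. -/

open Filter Topology Metric

/-! ### Covering lemma and weak type estimate. -/

/-- Vitali's covering lemma on the line, for balls on which `ν` is at least `t` times Lebesgue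
measure. -/
theorem exists_countable_vitali_subfamily (ν : Measure ℝ) (S : Set ℝ) (t : ℝ≥0∞) (R : ℝ)
    (T : Set (ℝ × ℝ))
    (hT : ∀ p ∈ T, 0 < p.2 ∧ p.2 ≤ R ∧ closedBall p.1 p.2 ⊆ S ∧
      t * volume (closedBall p.1 p.2) ≤ ν (closedBall p.1 p.2)) :
    ∃ u ⊆ T, u.Countable ∧
      (∀ p ∈ T, ∃ q ∈ u, closedBall p.1 p.2 ⊆ closedBall q.1 (5 * q.2)) ∧
      t * ∑' q : u, volume (closedBall q.1.1 q.1.2) ≤ ν S := by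
  obtain ⟨u, huT, hd, hcov⟩ := Vitali.exists_disjoint_subfamily_covering_enlargement_closedBall
    T Prod.fst Prod.snd R (fun p hp => (hT p hp).2.1) 5 (by norm_num)
  have hc : u.Countable := hd.countable_of_nonempty_interior fun p hp =>
    ⟨p.1, ball_subset_interior_closedBall (mem_ball_self (hT p (huT hp)).1)⟩
  refine ⟨u, huT, hc, hcov, ?_⟩
  rw [← ENNReal.tsum_mul_left]
  calc _ ≤ ∑' q : u, ν (closedBall q.1.1 q.1.2) :=
        ENNReal.tsum_le_tsum fun q => (hT _ (huT q.2)).2.2.2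
    _ = ν (⋃ q ∈ u, closedBall q.1 q.2) :=
        (measure_biUnion hc hd fun _ _ => measurableSet_closedBall).symm
    _ ≤ ν S := measure_mono (iUnion₂_subset fun q hq => (hT _ (huT hq)).2.2.1)

theorem volume_closedBall_five_mul (c r : ℝ) :
    volume (closedBall c (5 * r)) = 5 * volume (closedBall c r) := by
  rw [Real.volume_closedBall, Real.volume_closedBall,
    show 2 * (5 * r) = 5 * (2 * r) by ring, ENNReal.ofReal_mul (by norm_num)]
  norm_num

/-- The weak type estimate for a set covered by balls on which `ν` is large. -/
theorem mul_volume_le_of_forall_mem_closedBall (ν : Measure ℝ) (S E : Set ℝ) (t : ℝ≥0∞) (R : ℝ)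
    (hE : ∀ x ∈ E, ∃ c r, x ∈ closedBall c r ∧ 0 < r ∧ r ≤ R ∧ closedBall c r ⊆ S ∧
      t * volume (closedBall c r) ≤ ν (closedBall c r)) :
    t * volume E ≤ 5 * ν S := by
  obtain ⟨u, -, hc, hcov, hsum⟩ := exists_countable_vitali_subfamily ν S t R
    {p | 0 < p.2 ∧ p.2 ≤ R ∧ closedBall p.1 p.2 ⊆ S ∧
      t * volume (closedBall p.1 p.2) ≤ ν (closedBall p.1 p.2)} (fun p hp => hp)
  have hsub : E ⊆ ⋃ q ∈ u, closedBall q.1 (5 * q.2) := by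
    intro x hx
    obtain ⟨c, r, hxc, h⟩ := hE x hx
    obtain ⟨q, hq, hs⟩ := hcov (c, r) h
    exact mem_biUnion hq (hs hxc)
  calc t * volume E ≤ t * ∑' q : u, volume (closedBall q.1.1 (5 * q.1.2)) := by
        gcongr
        exact (measure_mono hsub).trans (measure_biUnion_le _ hc _)
    _ = 5 * (t * ∑' q : u, volume (closedBall q.1.1 q.1.2)) := by
        simp_rw [volume_closedBall_five_mul, ENNReal.tsum_mul_left]
        ring
    _ ≤ 5 * ν S := by gcongr

/-! ### Exponential integrability from level sets. -/

/-- The top layer n = ⌈y⌉ - 1 alone suffices, as e^(1/3) ≤ 3/2. The base 3/2 is below 2, so the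
series survives the decay 2⁻ⁿ of the level sets. -/
theorem ofReal_exp_div_three_le (y : ℝ) :
    ENNReal.ofReal (Real.exp (y / 3)) ≤
      1 + ∑' n : ℕ, (3 / 2 : ℝ≥0∞) ^ (n + 1) * indicator (Ioi (n : ℝ)) 1 y := by
  rcases le_or_gt y 0 with hy | hy
  · refine le_add_right ?_
    rw [← ENNReal.ofReal_one]
    exact ENNReal.ofReal_le_ofReal (Real.exp_le_one_iff.2 (by linarith))
  · obtain ⟨n, hn⟩ : ∃ n, ⌈y⌉₊ = n + 1 :=
      Nat.exists_eq_succ_of_ne_zero (Nat.ceil_pos.2 hy).ne'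
    have h1 : y ≤ n + 1 := by
      have := Nat.le_ceil y
      rw [hn] at this
      exact_mod_cast this
    have h2 : (n : ℝ) < y := Nat.lt_ceil.1 (by omega)
    refine le_add_left (le_trans ?_ (ENNReal.le_tsum n))
    rw [indicator_of_mem (mem_Ioi.2 h2), Pi.one_apply, mul_one]
    have h3 : Real.exp (1 / 3) ≤ 3 / 2 := by
      have h4 : Real.exp (1 / 3) ^ 3 ≤ (3 / 2) ^ 3 := by
        rw [← Real.exp_nat_mul]
        norm_num
        linarith [Real.exp_one_lt_d9]
      exact le_of_pow_le_pow_left₀ (by norm_num) (by norm_num) h4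
    have h5 : Real.exp (y / 3) ≤ (3 / 2) ^ (n + 1) := by
      calc Real.exp (y / 3) ≤ Real.exp ((n + 1 : ℕ) * (1 / 3)) := by
            apply Real.exp_le_exp.2
            push_cast
            linarith
        _ = Real.exp (1 / 3) ^ (n + 1) := Real.exp_nat_mul _ _
        _ ≤ _ := by gcongr
    calc ENNReal.ofReal (Real.exp (y / 3)) ≤ ENNReal.ofReal ((3 / 2) ^ (n + 1)) :=
          ENNReal.ofReal_le_ofReal h5
      _ = _ := by
          rw [ENNReal.ofReal_pow (by norm_num), ENNReal.ofReal_div_of_pos (by norm_num)]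
          norm_num

/-- Exponential integrability from geometric decay of the distribution function. -/
theorem lintegral_exp_div_three_le {μ : Measure ℝ} {y : ℝ → ℝ} (hy : AEMeasurable y μ)
    (D : ℝ≥0∞) (h : ∀ n : ℕ, μ {x | (n : ℝ) < y x} ≤ 2⁻¹ ^ n * D) :
    ∫⁻ x, ENNReal.ofReal (Real.exp (y x / 3)) ∂μ ≤ μ univ + 6 * D := by
  have hm : ∀ n : ℕ, NullMeasurableSet {x | (n : ℝ) < y x} μ := fun n =>
    hy.nullMeasurable measurableSet_Ioi
  calc ∫⁻ x, ENNReal.ofReal (Real.exp (y x / 3)) ∂μ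
      ≤ ∫⁻ x, (1 + ∑' n : ℕ, (3 / 2 : ℝ≥0∞) ^ (n + 1) *
          indicator {x | (n : ℝ) < y x} 1 x) ∂μ :=
        lintegral_mono fun x => ofReal_exp_div_three_le (y x)
    _ = μ univ + ∑' n : ℕ, (3 / 2 : ℝ≥0∞) ^ (n + 1) * μ {x | (n : ℝ) < y x} := by
        rw [lintegral_add_left measurable_const, lintegral_one, lintegral_tsum]
        · congr 1
          refine tsum_congr fun n => ?_
          rw [← lintegral_indicator_one₀ (hm n)]
          exact lintegral_const_mul'' _ (aemeasurable_one.indicator₀ (hm n))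
        · exact fun n => (aemeasurable_one.indicator₀ (hm n)).const_mul _
    -- The ratio is (3/2)(1/2) = 3/4, so the series sums to (3/2) · 4 = 6.
    _ ≤ μ univ + ∑' n : ℕ, (3 / 2 : ℝ≥0∞) * D * (3 / 4) ^ n := by
        refine add_le_add le_rfl (ENNReal.tsum_le_tsum fun n => ?_)
        calc (3 / 2 : ℝ≥0∞) ^ (n + 1) * μ {x | (n : ℝ) < y x}
            ≤ (3 / 2 : ℝ≥0∞) ^ (n + 1) * (2⁻¹ ^ n * D) := by gcongr; exact h n
          _ = (3 / 2 : ℝ≥0∞) * D * ((3 / 2) * 2⁻¹) ^ n := by rw [mul_pow]; ring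
          _ = _ := by
              congr 2
              rw [div_eq_mul_inv, div_eq_mul_inv, mul_assoc,
                ← ENNReal.mul_inv (by simp) (by simp)]
              norm_num
    _ = μ univ + 6 * D := by
        rw [ENNReal.tsum_mul_left, ENNReal.tsum_geometric]
        have : (1 - 3 / 4 : ℝ≥0∞) = 4⁻¹ := by
          refine ENNReal.sub_eq_of_eq_add_rev (by finiteness) ?_
          rw [div_eq_mul_inv, show (3 : ℝ≥0∞) * 4⁻¹ + 4⁻¹ = 4 * 4⁻¹ by ring,
            ENNReal.mul_inv_cancel (by simp) (by simp)]
        rw [this, inv_inv, mul_right_comm]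
        congr 2
        rw [div_eq_mul_inv, show (4 : ℝ≥0∞) = 2 * 2 by norm_num,
          show (3 : ℝ≥0∞) * 2⁻¹ * (2 * 2) = 3 * 2 * (2⁻¹ * 2) by ring,
          ENNReal.inv_mul_cancel (by simp) (by simp)]
        norm_num

/-! ### Measurability of the maximal function. -/

/-- An interval whose mean exceeds t can be widened slightly with its mean still above t; it then
has x in its interior and serves all nearby points. -/
theorem lowerSemicontinuous_hlMaximal (g : ℝ → ℝ) : LowerSemicontinuous (hlMaximal g) := by
  intro x t ht
  simp only [hlMaximal, lt_iSup_iff] at ht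
  obtain ⟨a, b, hab, hx, ht⟩ := ht
  rw [setLAverage_eq, Real.volume_Icc, ENNReal.lt_div_iff_mul_lt (by simp [hab]) (by simp)] at ht
  have ht0 : t ≠ ∞ := by
    rintro rfl
    rw [ENNReal.top_mul (by simp [hab])] at ht
    exact not_top_lt ht
  have hlim : Tendsto (fun ε : ℝ => t * ENNReal.ofReal (b + ε - (a - ε))) (𝓝[>] 0)
      (𝓝 (t * ENNReal.ofReal (b - a))) := by
    refine ENNReal.Tendsto.const_mul (tendsto_nhdsWithin_of_tendsto_nhds ?_) (Or.inr ht0)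
    refine ENNReal.tendsto_ofReal ?_
    have : Continuous fun ε : ℝ => b + ε - (a - ε) := by fun_prop
    simpa using this.tendsto 0
  obtain ⟨ε, hε, hε0⟩ := ((hlim.eventually_lt_const ht).and self_mem_nhdsWithin).exists
  have hε0 : 0 < ε := hε0
  have hab' : a - ε < b + ε := by linarith
  filter_upwards [Ioo_mem_nhds (show a - ε < x by linarith [hx.1])
    (show x < b + ε by linarith [hx.2])] with z hz
  simp only [hlMaximal, lt_iSup_iff]
  refine ⟨a - ε, b + ε, hab', Ioo_subset_Icc_self hz, ?_⟩
  rw [setLAverage_eq, Real.volume_Icc,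
    ENNReal.lt_div_iff_mul_lt (by simp [hab']) (by simp)]
  exact hε.trans_le (lintegral_mono_set (Icc_subset_Icc (by linarith) (by linarith)))

theorem measurable_hlMaximal (g : ℝ → ℝ) : Measurable (hlMaximal g) :=
  (lowerSemicontinuous_hlMaximal g).measurable

theorem setLAverage_le_hlMaximal (g : ℝ → ℝ) {a b x : ℝ} (hab : a < b) (hx : x ∈ Icc a b) :
    ⨍⁻ t in Icc a b, ‖g t‖ₑ ∂volume ≤ hlMaximal g x :=
  le_iSup_of_le a <| le_iSup_of_le b <| le_iSup_of_le hab <| le_iSup_of_le hx le_rfl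

/-! ### John–Nirenberg inequality for BLO. -/

/-- Stopping-time selection of an interval on which the mean of `h` is comparable to `L`. -/
theorem ae_exists_stopping_interval {h : ℝ → ℝ} (hh : LocallyIntegrable h) {a b L : ℝ}
    (hab : a < b) (h0 : ∀ᵐ x ∂volume.restrict (Icc a b), 0 ≤ h x)
    (hL : ∫ x in Icc a b, h x ≤ L * (b - a)) :
    ∀ᵐ x, x ∈ Icc a b → L < h x → ∃ c r, 0 < r ∧ x ∈ closedBall c r ∧
      closedBall c r ⊆ Icc a b ∧ L * (2 * r) ≤ ∫ y in closedBall c r, h y ∧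
      ∫ y in closedBall c r, h y ≤ 2 * L * (2 * r) := by
  filter_upwards [IsUnifLocDoublingMeasure.ae_tendsto_average (μ := volume) hh 1] with x hx hxI hLx
  -- Contracting [a, b] towards x by the factor 2⁻ᵏ gives nested intervals that contain x, even when
  -- x is an endpoint.
  let c : ℕ → ℝ := fun k => x + (1 / 2) ^ k * ((a + b) / 2 - x)
  let r : ℕ → ℝ := fun k => (1 / 2) ^ k * ((b - a) / 2)
  have hp : ∀ k : ℕ, (0 : ℝ) < (1 / 2) ^ k := fun k => by positivity
  have hr : ∀ k, 0 < r k := fun k => mul_pos (hp k) (by linarith)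
  have hball : ∀ k, closedBall (c k) (r k) =
      Icc (x - (1 / 2) ^ k * (x - a)) (x + (1 / 2) ^ k * (b - x)) := fun k => by
    rw [Real.closedBall_eq_Icc]
    congr 1 <;> simp only [c, r] <;> ring
  have hmem : ∀ k, x ∈ closedBall (c k) (r k) := fun k => by
    rw [hball]
    constructor <;> nlinarith [hp k, hxI.1, hxI.2]
  have hanti : ∀ k, closedBall (c (k + 1)) (r (k + 1)) ⊆ closedBall (c k) (r k) := fun k => by
    rw [hball, hball]
    apply Icc_subset_Icc <;> rw [pow_succ] <;> nlinarith [hp k, hxI.1, hxI.2]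
  have hzero : closedBall (c 0) (r 0) = Icc a b := by
    rw [hball]
    congr 1 <;> ring
  have hsub : ∀ k, closedBall (c k) (r k) ⊆ Icc a b := fun k => by
    induction k with
    | zero => exact hzero.subset
    | succ k ih => exact (hanti k).trans ih
  have hlim : Tendsto r atTop (𝓝[>] 0) := by
    refine tendsto_nhdsWithin_iff.2 ⟨?_, .of_forall hr⟩
    have := (tendsto_pow_atTop_nhds_zero_of_lt_one (r := (1 / 2 : ℝ)) (by norm_num)
      (by norm_num)).mul_const ((b - a) / 2)
    rwa [zero_mul] at this
  have hex : ∃ k, L * (2 * r k) < ∫ y in closedBall (c k) (r k), h y := by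
    obtain ⟨k, hk⟩ := ((hx c r hlim (.of_forall fun k => by
      rw [one_mul]; exact hmem k)).eventually_const_lt hLx).exists
    refine ⟨k, ?_⟩
    have := hr k
    rw [setAverage_eq, Measure.real, Real.volume_closedBall,
      ENNReal.toReal_ofReal (by linarith), smul_eq_mul, inv_mul_eq_div,
      lt_div_iff₀ (by linarith)] at hk
    exact hk
  classical
  -- Stop at the first k where the mean exceeds L. It is not 0 by `hL`, so the parent has mean at
  -- most L, and halving the length at most doubles the mean since h ≥ 0.
  have hspec := Nat.find_spec hex
  obtain ⟨j, hj⟩ : ∃ j, Nat.find hex = j + 1 := by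
    refine Nat.exists_eq_succ_of_ne_zero fun h0 => ?_
    rw [h0, hzero] at hspec
    have : 2 * r 0 = b - a := by simp only [r]; ring
    rw [this] at hspec
    linarith
  have hmin := Nat.find_min hex (show j < Nat.find hex by omega)
  rw [hj] at hspec
  refine ⟨c (j + 1), r (j + 1), hr _, hmem _, hsub _, hspec.le, ?_⟩
  calc ∫ y in closedBall (c (j + 1)) (r (j + 1)), h y
      ≤ ∫ y in closedBall (c j) (r j), h y := by
        refine setIntegral_mono_set (hh.integrableOn_isCompact (isCompact_closedBall _ _))
          (ae_restrict_of_ae_restrict_of_subset (hsub j) h0) (hanti j).eventuallyLE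
    _ ≤ L * (2 * r j) := not_lt.1 hmin
    _ = 2 * L * (2 * r (j + 1)) := by simp only [r, pow_succ]; ring

theorem withDensity_ofReal_apply {h : ℝ → ℝ} (hh : LocallyIntegrable h) {I K : Set ℝ}
    (h0 : ∀ᵐ x ∂volume.restrict I, 0 ≤ h x) (hK : IsCompact K) (hKI : K ⊆ I) :
    (volume.restrict I).withDensity (fun x => ENNReal.ofReal (h x)) K =
      ENNReal.ofReal (∫ x in K, h x) := by
  rw [withDensity_apply _ hK.measurableSet, Measure.restrict_restrict hK.measurableSet,
    inter_eq_self_of_subset_left hKI, ofReal_integral_eq_lintegral_ofReal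
      (hh.integrableOn_isCompact hK) (ae_restrict_of_ae_restrict_of_subset hKI h0)]

theorem setIntegral_Icc_sub_const {f : ℝ → ℝ} (hf : LocallyIntegrable f) (m : ℝ) {a b : ℝ}
    (hab : a ≤ b) :
    ∫ x in Icc a b, (f x - m) = (∫ x in Icc a b, f x) - m * (b - a) := by
  rw [integral_sub (hf.integrableOn_isCompact isCompact_Icc)
    ((locallyIntegrable_const m).integrableOn_isCompact isCompact_Icc), setIntegral_const,
    Measure.real, Real.volume_Icc, ENNReal.toReal_ofReal (by linarith), smul_eq_mul, mul_comm m]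

/-- The John–Nirenberg inequality for bounded lower oscillation. -/
theorem volume_superlevel_le {f : ℝ → ℝ} (hf : LocallyIntegrable f) {N : ℝ} (hN : 0 < N)
    (H : ∀ a b, a < b → ∃ m, (∀ᵐ x ∂volume.restrict (Icc a b), m ≤ f x) ∧
      ∫ x in Icc a b, f x ≤ (m + N) * (b - a)) (n : ℕ) :
    ∀ a b m, a < b → (∀ᵐ x ∂volume.restrict (Icc a b), m ≤ f x) →
      ∫ x in Icc a b, f x ≤ (m + N) * (b - a) →
      volume ({x | m + 20 * N * n < f x} ∩ Icc a b) ≤ 2⁻¹ ^ n * ENNReal.ofReal (b - a) := by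
  induction n with
  | zero =>
    intro a b m _ _ _
    rw [pow_zero, one_mul, ← Real.volume_Icc]
    exact measure_mono inter_subset_right
  | succ n ih =>
    intro a b m hab hm hint
    set h : ℝ → ℝ := fun x => f x - m with hdef
    have hh : LocallyIntegrable h := hf.sub (locallyIntegrable_const m)
    have h0 : ∀ᵐ x ∂volume.restrict (Icc a b), 0 ≤ h x := by
      filter_upwards [hm] with x hx using sub_nonneg.2 hx
    have hhI : ∫ x in Icc a b, h x ≤ N * (b - a) := by
      rw [setIntegral_Icc_sub_const hf m hab.le]
      linarith
    set ν := (volume.restrict (Icc a b)).withDensity (fun x => ENNReal.ofReal (h x)) with hν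
    set T : Set (ℝ × ℝ) := {p | 0 < p.2 ∧ closedBall p.1 p.2 ⊆ Icc a b ∧
      10 * N * (2 * p.2) ≤ ∫ y in closedBall p.1 p.2, h y ∧
      ∫ y in closedBall p.1 p.2, h y ≤ 2 * (10 * N) * (2 * p.2)}
    obtain ⟨u, huT, huc, hcov, hsum⟩ := exists_countable_vitali_subfamily ν (Icc a b)
      (ENNReal.ofReal (10 * N)) (b - a) T (by
        rintro ⟨c, r⟩ ⟨hr, hsub, hlow, -⟩
        dsimp only at hr hsub hlow
        refine ⟨hr, ?_, hsub, ?_⟩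
        · rw [Real.closedBall_eq_Icc, Icc_subset_Icc_iff (by linarith)] at hsub
          dsimp only
          linarith
        · rw [hν, withDensity_ofReal_apply hh h0 (isCompact_closedBall _ _) hsub,
            Real.volume_closedBall, ← ENNReal.ofReal_mul (by positivity)]
          exact ENNReal.ofReal_le_ofReal hlow)
    -- The intervals are disjoint with mean of h at least 10N, while h has integral at most N(b -
    -- a).
    have hsum' : ∑' q : u, volume (closedBall q.1.1 q.1.2) ≤ ENNReal.ofReal ((b - a) / 10) := by
      rw [hν, withDensity_ofReal_apply hh h0 isCompact_Icc subset_rfl] at hsum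
      have h10 : ENNReal.ofReal (10 * N) * ∑' q : u, volume (closedBall q.1.1 q.1.2) ≤
          ENNReal.ofReal (10 * N) * ENNReal.ofReal ((b - a) / 10) := by
        rw [← ENNReal.ofReal_mul (by positivity)]
        refine hsum.trans (ENNReal.ofReal_le_ofReal (hhI.trans_eq ?_))
        ring
      exact (ENNReal.mul_le_mul_iff_right (by simpa using hN) ENNReal.ofReal_ne_top).1 h10
    set E := {x | m + 20 * N * (n + 1 : ℕ) < f x} ∩ Icc a b
    have hEcov : E ≤ᵐ[volume] ⋃ q ∈ u, E ∩ closedBall q.1 (5 * q.2) := by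
      filter_upwards [ae_exists_stopping_interval hh hab h0 (L := 10 * N)
        (hhI.trans (by nlinarith))] with x hx hxE
      have hxE : x ∈ E := hxE
      have h1 : 10 * N < h x := by
        have h2 : m + 20 * N * (n + 1 : ℕ) < f x := hxE.1
        have h3 : 0 ≤ N * n := by positivity
        push_cast at h2
        simp only [hdef]
        nlinarith
      obtain ⟨c, r, hr, hxc, hsub, hlow, hup⟩ := hx hxE.2 h1
      obtain ⟨q, hq, hqs⟩ := hcov (c, r) ⟨hr, hsub, hlow, hup⟩
      exact mem_biUnion hq ⟨hxE, hqs hxc⟩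
    have hpiece : ∀ q ∈ u, volume (E ∩ closedBall q.1 (5 * q.2)) ≤
        2⁻¹ ^ n * (5 * volume (closedBall q.1 q.2)) := by
      intro q hq
      obtain ⟨hr, hsub, -, hup⟩ := huT hq
      rw [Real.closedBall_eq_Icc] at hsub hup
      have hsub' := (Icc_subset_Icc_iff (by linarith)).1 hsub
      -- The fivefold enlargement is clipped to [a, b]; it still contains the stopping interval
      -- itself.
      set a' := max a (q.1 - 5 * q.2)
      set b' := min b (q.1 + 5 * q.2)
      have ha' : a' ≤ q.1 - q.2 := max_le hsub'.1 (by linarith)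
      have hb' : q.1 + q.2 ≤ b' := le_min hsub'.2 (by linarith)
      have hab' : a' < b' := by linarith
      obtain ⟨m', hm', hint'⟩ := H a' b' hab'
      -- On the stopping interval the mean of f is at least m' and at most m + 20N. Thus one level
      -- step of 20N absorbs the change of lower bound.
      have hmm : m' ≤ m + 20 * N := by
        have h1 : 0 ≤ ∫ x in Icc (q.1 - q.2) (q.1 + q.2), (f x - m') := by
          refine integral_nonneg_of_ae ?_
          filter_upwards [ae_restrict_of_ae_restrict_of_subset (Icc_subset_Icc ha' hb') hm']
            with x hx using sub_nonneg.2 hx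
        rw [setIntegral_Icc_sub_const hf m' (by linarith)] at h1
        rw [setIntegral_Icc_sub_const hf m (by linarith)] at hup
        have h2 : (m' - m - 20 * N) * (2 * q.2) ≤ 0 := by linarith
        have h3 := nonpos_of_mul_nonpos_left h2 (by linarith)
        linarith
      rw [← volume_closedBall_five_mul, Real.volume_closedBall]
      calc volume (E ∩ closedBall q.1 (5 * q.2))
          ≤ volume ({x | m' + 20 * N * n < f x} ∩ Icc a' b') := by
            refine measure_mono ?_
            rintro x ⟨⟨hx1, hx2⟩, hx3⟩
            rw [Real.closedBall_eq_Icc] at hx3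
            refine ⟨?_, max_le hx2.1 hx3.1, le_min hx2.2 hx3.2⟩
            have hx1 : m + 20 * N * (n + 1 : ℕ) < f x := hx1
            push_cast at hx1
            change m' + 20 * N * n < f x
            linarith
        _ ≤ 2⁻¹ ^ n * ENNReal.ofReal (b' - a') := ih a' b' m' hab' hm' hint'
        _ ≤ _ := by
            gcongr
            have := le_max_right a (q.1 - 5 * q.2)
            have := min_le_right b (q.1 + 5 * q.2)
            linarith
    calc volume E ≤ volume (⋃ q ∈ u, E ∩ closedBall q.1 (5 * q.2)) := measure_mono_ae hEcov
      _ ≤ ∑' q : u, volume (E ∩ closedBall q.1.1 (5 * q.1.2)) := measure_biUnion_le _ huc _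
      _ ≤ ∑' q : u, 2⁻¹ ^ n * (5 * volume (closedBall q.1.1 q.1.2)) :=
          ENNReal.tsum_le_tsum fun q => hpiece q q.2
      _ = 2⁻¹ ^ n * (5 * ∑' q : u, volume (closedBall q.1.1 q.1.2)) := by
          rw [ENNReal.tsum_mul_left, ENNReal.tsum_mul_left]
      -- Enlargement costs 5 and the total length is a tenth, which gives the new factor 1/2.
      _ ≤ 2⁻¹ ^ n * (5 * ENNReal.ofReal ((b - a) / 10)) := by gcongr
      _ = 2⁻¹ ^ (n + 1) * ENNReal.ofReal (b - a) := by
          have h5 : (5 : ℝ≥0∞) = ENNReal.ofReal 5 := by norm_num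
          have h2 : (2⁻¹ : ℝ≥0∞) = ENNReal.ofReal 2⁻¹ := by
            rw [ENNReal.ofReal_inv_of_pos (by norm_num)]; norm_num
          rw [pow_succ, mul_assoc, h5, ← ENNReal.ofReal_mul (by norm_num)]
          congr 1
          rw [h2, ← ENNReal.ofReal_mul (by norm_num)]
          congr 1
          ring

/-! ### A₁ weights and their maximal functions. -/

/-- `exp (f / (60 N))` is a Muckenhoupt `A₁` weight. -/
theorem lintegral_exp_div_le {f : ℝ → ℝ} (hf : LocallyIntegrable f) {N : ℝ} (hN : 0 < N)
    (H : ∀ a b, a < b → ∃ m, (∀ᵐ x ∂volume.restrict (Icc a b), m ≤ f x) ∧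
      ∫ x in Icc a b, f x ≤ (m + N) * (b - a)) {a b : ℝ} (hab : a < b) :
    ∃ m, (∀ᵐ x ∂volume.restrict (Icc a b), m ≤ f x) ∧
      ∫⁻ x in Icc a b, ENNReal.ofReal (Real.exp (f x / (60 * N))) ≤
        7 * ENNReal.ofReal (Real.exp (m / (60 * N))) * ENNReal.ofReal (b - a) := by
  obtain ⟨m, hm, hint⟩ := H a b hab
  refine ⟨m, hm, ?_⟩
  have hfm : AEMeasurable f (volume.restrict (Icc a b)) :=
    hf.aestronglyMeasurable.aemeasurable.restrict
  have hy : AEMeasurable (fun x => (f x - m) / (20 * N)) (volume.restrict (Icc a b)) :=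
    (hfm.sub_const m).div_const _
  have key := lintegral_exp_div_three_le hy (ENNReal.ofReal (b - a)) (fun n => by
    rw [Measure.restrict_apply' measurableSet_Icc]
    refine (measure_mono (inter_subset_inter_left _ fun x hx => ?_)).trans
      (volume_superlevel_le hf hN H n a b m hab hm hint)
    have hx : (n : ℝ) < (f x - m) / (20 * N) := hx
    rw [lt_div_iff₀ (by positivity)] at hx
    change m + 20 * N * n < f x
    linarith)
  rw [Measure.restrict_apply_univ, Real.volume_Icc] at key
  calc ∫⁻ x in Icc a b, ENNReal.ofReal (Real.exp (f x / (60 * N)))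
      = ∫⁻ x in Icc a b, ENNReal.ofReal (Real.exp (m / (60 * N))) *
          ENNReal.ofReal (Real.exp ((f x - m) / (20 * N) / 3)) := by
        refine lintegral_congr fun x => ?_
        rw [← ENNReal.ofReal_mul (Real.exp_nonneg _), ← Real.exp_add]
        congr 2
        field_simp
        ring
    _ = ENNReal.ofReal (Real.exp (m / (60 * N))) *
          ∫⁻ x in Icc a b, ENNReal.ofReal (Real.exp ((f x - m) / (20 * N) / 3)) :=
        lintegral_const_mul' _ _ ENNReal.ofReal_ne_top
    _ ≤ ENNReal.ofReal (Real.exp (m / (60 * N))) *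
          (ENNReal.ofReal (b - a) + 6 * ENNReal.ofReal (b - a)) := by gcongr
    _ = _ := by ring

/-- Lebesgue differentiation along intervals centred at x. -/
theorem ae_ofReal_le_hlMaximal {w : ℝ → ℝ} (hw : LocallyIntegrable w) (h0 : ∀ x, 0 ≤ w x) :
    ∀ᵐ x, ENNReal.ofReal (w x) ≤ hlMaximal w x := by
  filter_upwards [IsUnifLocDoublingMeasure.ae_tendsto_average (μ := volume) hw 1] with x hx
  have hδ : ∀ k : ℕ, (0 : ℝ) < 1 / (k + 1) := fun k => by positivity
  have hlim := hx (fun _ : ℕ => x) (fun k : ℕ => 1 / ((k : ℝ) + 1))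
    (tendsto_nhdsWithin_iff.2 ⟨tendsto_one_div_add_atTop_nhds_zero_nat, .of_forall hδ⟩)
    (.of_forall fun k => mem_closedBall_self (by rw [one_mul]; exact (hδ k).le))
  refine le_of_tendsto (ENNReal.tendsto_ofReal hlim) (.of_forall fun k => ?_)
  have hk := hδ k
  rw [ofReal_setAverage (hw.integrableOn_isCompact (isCompact_closedBall _ _))
    (.of_forall h0), ← setLAverage_eq, Real.closedBall_eq_Icc]
  simp_rw [← Real.enorm_of_nonneg (h0 _)]
  exact setLAverage_le_hlMaximal w (by linarith) ⟨by linarith, by linarith⟩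

/-- An `A₁` condition on every interval bounds the maximal function pointwise. -/
theorem ae_hlMaximal_le {w : ℝ → ℝ} {C : ℝ≥0∞} {W : ℝ → ℝ≥0∞}
    (hA : ∀ a b, a < b → ∀ᵐ x ∂volume.restrict (Icc a b),
      ∫⁻ t in Icc a b, ‖w t‖ₑ ≤ C * W x * ENNReal.ofReal (b - a)) :
    ∀ᵐ x, hlMaximal w x ≤ 2 * C * W x := by
  -- Only countably many exceptional sets may be discarded, so endpoints are made rational; the
  -- enlarged interval is at most twice as long, whence the factor 2.
  have hrat : ∀ᵐ x, ∀ p q : ℚ, (p : ℝ) < q → x ∈ Icc (p : ℝ) q →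
      ∫⁻ t in Icc (p : ℝ) q, ‖w t‖ₑ ≤ C * W x * ENNReal.ofReal (q - p) := by
    refine ae_all_iff.2 fun p => ae_all_iff.2 fun q => ?_
    by_cases hpq : (p : ℝ) < q
    · filter_upwards [(ae_restrict_iff' measurableSet_Icc).1 (hA p q hpq)] with x hx _ using hx
    · exact .of_forall fun x h => absurd h hpq
  filter_upwards [hrat] with x hx
  refine iSup_le fun a => iSup_le fun b => iSup_le fun hab => iSup_le fun hxab => ?_
  obtain ⟨p, hp1, hp2⟩ := exists_rat_btwn (show a - (b - a) / 2 < a by linarith)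
  obtain ⟨q, hq1, hq2⟩ := exists_rat_btwn (show b < b + (b - a) / 2 by linarith)
  rw [setLAverage_eq, Real.volume_Icc]
  refine ENNReal.div_le_of_le_mul ?_
  calc ∫⁻ t in Icc a b, ‖w t‖ₑ ≤ ∫⁻ t in Icc (p : ℝ) q, ‖w t‖ₑ :=
        lintegral_mono_set (Icc_subset_Icc hp2.le hq1.le)
    _ ≤ C * W x * ENNReal.ofReal (q - p) :=
        hx p q (by linarith) ⟨hp2.le.trans hxab.1, hxab.2.trans hq1.le⟩
    _ ≤ C * W x * ENNReal.ofReal (2 * (b - a)) := by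
        gcongr
        linarith
    _ = 2 * C * W x * ENNReal.ofReal (b - a) := by
        rw [ENNReal.ofReal_mul (by norm_num), ENNReal.ofReal_ofNat]
        ring

/-! ### Upper bound for the new norm. -/

theorem exists_lower_bound_of_bloNorm_le {f : ℝ → ℝ} {N : ℝ} (hN : 0 ≤ N)
    (h : bloNorm f ≤ ENNReal.ofReal N) (a b : ℝ) (hab : a < b) :
    ∃ m, (∀ᵐ x ∂volume.restrict (Icc a b), m ≤ f x) ∧
      ∫ x in Icc a b, f x ≤ (m + N) * (b - a) := by
  have hosc : lowerOscillation f a b ≤ ENNReal.ofReal N :=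
    (le_iSup₂_of_le a b <| le_iSup (fun _ : a < b => lowerOscillation f a b) hab).trans h
  unfold lowerOscillation at hosc
  have hae : ∀ᵐ x ∂volume.restrict (Icc a b),
      essInf (fun x : ℝ => (f x : EReal)) (volume.restrict (Icc a b)) ≤ (f x : EReal) :=
    ae_essInf_le
  set A : ℝ := ⨍ x in Icc a b, f x with hA
  generalize essInf (fun x : ℝ => (f x : EReal)) (volume.restrict (Icc a b)) = e at hosc hae
  have : NeBot (ae (volume.restrict (Icc a b))) := by
    rw [ae_neBot, Ne, Measure.restrict_eq_zero, Real.volume_Icc]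
    simpa using hab
  -- An infimum `⊥` would make the oscillation infinite; `⊤` is impossible for a real-valued f on a
  -- set of positive measure.
  induction e with
  | bot => simp at hosc
  | top =>
    obtain ⟨x, hx⟩ := hae.exists
    simp at hx
  | coe m =>
    refine ⟨m, hae.mono fun x hx => EReal.coe_le_coe_iff.1 hx, ?_⟩
    rw [← EReal.coe_sub, EReal.toENNReal_of_ne_top (EReal.coe_ne_top _), EReal.toReal_coe,
      ENNReal.ofReal_le_ofReal_iff hN, hA, setAverage_eq, Measure.real, Real.volume_Icc,
      ENNReal.toReal_ofReal (by linarith), smul_eq_mul, inv_mul_eq_div, sub_le_iff_le_add',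
      div_le_iff₀ (by linarith)] at hosc
    exact hosc

theorem bloNorm'_le {f : ℝ → ℝ} (hf : LocallyIntegrable f) {N : ℝ} (hN : 0 < N)
    (h : bloNorm f ≤ ENNReal.ofReal N) : bloNorm' f ≤ ENNReal.ofReal (900 * N) := by
  have H := exists_lower_bound_of_bloNorm_le hN.le h
  -- Levels are spaced by 20N and exp(y/3) is what is integrable, so the scale is 3 · 20N.
  set α := 60 * N with hα
  have hα0 : 0 < α := by positivity
  set w : ℝ → ℝ := fun x => Real.exp (f x / α)
  have hw0 : ∀ x, 0 < w x := fun x => Real.exp_pos _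
  have hfm : AEMeasurable f := hf.aestronglyMeasurable.aemeasurable
  have hwm : AEStronglyMeasurable w volume :=
    (Real.measurable_exp.comp_aemeasurable (hfm.div_const α)).aestronglyMeasurable
  have henorm : ∀ x, ‖w x‖ₑ = ENNReal.ofReal (w x) := fun x => Real.enorm_of_nonneg (hw0 x).le
  have hwint : LocallyIntegrable w := by
    refine locallyIntegrable_iff.2 fun K hK => ?_
    obtain ⟨R, hR, hKR⟩ := hK.isBounded.subset_closedBall_lt 0 0
    rw [Real.closedBall_eq_Icc] at hKR
    refine IntegrableOn.mono_set ⟨hwm.restrict, ?_⟩ hKR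
    obtain ⟨m, -, hm⟩ := lintegral_exp_div_le hf hN H (show 0 - R < 0 + R by linarith)
    rw [HasFiniteIntegral]
    simp_rw [henorm]
    exact hm.trans_lt (by finiteness)
  have hlow := ae_ofReal_le_hlMaximal hwint fun x => (hw0 x).le
  have hup := ae_hlMaximal_le (w := w) (C := 7) (W := fun x => ENNReal.ofReal (w x)) (by
    intro a b hab
    obtain ⟨m, hm, hint⟩ := lintegral_exp_div_le hf hN H hab
    filter_upwards [hm] with x hx
    simp_rw [henorm]
    refine hint.trans ?_
    gcongr
    exact Real.exp_le_exp.2 (by gcongr))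
  set β : ℝ → ℝ := fun x => f x - α * Real.log (hlMaximal w x).toReal with hβ
  have hβm : AEStronglyMeasurable β volume := (hfm.sub
    ((measurable_hlMaximal w).ennreal_toReal.log.const_mul α).aemeasurable).aestronglyMeasurable
  -- From w ≤ Mw ≤ 14 w, with the crude bound log 14 ≤ 14. The total is α + 14α = 900N.
  have hβb : ∀ᵐ x, ‖β x‖ ≤ α * 14 := by
    filter_upwards [hlow, hup] with x h1 h2
    have htop : hlMaximal w x ≠ ∞ := ne_top_of_le_ne_top (by finiteness) h2
    rw [show (2 * 7 : ℝ≥0∞) = ENNReal.ofReal 14 by norm_num,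
      ← ENNReal.ofReal_mul (by norm_num)] at h2
    have h1' : w x ≤ (hlMaximal w x).toReal := (ENNReal.ofReal_le_iff_le_toReal htop).1 h1
    have h2' : (hlMaximal w x).toReal ≤ 14 * w x :=
      ENNReal.toReal_le_of_le_ofReal (by have := hw0 x; positivity) h2
    have hlogw : Real.log (w x) = f x / α := Real.log_exp _
    have h3 := Real.log_le_log (hw0 x) h1'
    have h4 := Real.log_le_log ((hw0 x).trans_le h1') h2'
    rw [Real.log_mul (by norm_num) (hw0 x).ne'] at h4
    have h5 := Real.log_le_self (show (0 : ℝ) ≤ 14 by norm_num)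
    have h6 : f x = α * Real.log (w x) := by rw [hlogw]; field_simp
    rw [Real.norm_eq_abs, abs_le]
    simp only [hβ, h6]
    constructor <;> nlinarith
  have hdec : IsLogMaximalDecomposition f α w β := by
    refine ⟨hα0, hwint, memLp_top_of_bound hβm _ hβb, ?_⟩
    filter_upwards [hlow, hup] with x h1 h2
    rw [ENNReal.log_pos_real
      ((ENNReal.ofReal_pos.2 (hw0 x)).trans_le h1).ne' (ne_top_of_le_ne_top (by finiteness) h2),
      ← EReal.coe_mul, ← EReal.coe_add]
    congr 1
    simp only [hβ]
    ring
  calc bloNorm' f ≤ ENNReal.ofReal α + eLpNorm β ∞ volume :=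
        iInf_le_of_le α <| iInf_le_of_le w <| iInf_le_of_le β <| iInf_le_of_le hdec le_rfl
    _ ≤ ENNReal.ofReal α + ENNReal.ofReal (α * 14) := by
        gcongr
        simpa using eLpNorm_le_of_ae_bound (p := ∞) hβb
    _ = ENNReal.ofReal (900 * N) := by
        rw [← ENNReal.ofReal_add hα0.le (by positivity)]
        congr 1
        rw [hα]
        ring

/-! ### Lower oscillation of log(Mg). -/

theorem lowerOscillation_le {f : ℝ → ℝ} {a b c C : ℝ} (hab : a < b)
    (hlow : ∀ᵐ x ∂volume.restrict (Icc a b), c ≤ f x)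
    (hup : ∫ x in Icc a b, f x ≤ C * (b - a)) :
    lowerOscillation f a b ≤ ENNReal.ofReal (C - c) := by
  have h1 : ((⨍ x in Icc a b, f x : ℝ) : EReal) ≤ (C : EReal) := by
    rw [EReal.coe_le_coe_iff, setAverage_eq, Measure.real, Real.volume_Icc,
      ENNReal.toReal_ofReal (by linarith), smul_eq_mul, inv_mul_eq_div,
      div_le_iff₀ (by linarith)]
    exact hup
  have h2 : (c : EReal) ≤ essInf (fun x : ℝ => (f x : EReal)) (volume.restrict (Icc a b)) :=
    le_essInf_of_ae_le _ (hlow.mono fun x hx => EReal.coe_le_coe_iff.2 hx)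
  refine (EReal.toENNReal_le_toENNReal (EReal.sub_le_sub h1 h2)).trans_eq ?_
  rw [← EReal.coe_sub, EReal.toENNReal_of_ne_top (EReal.coe_ne_top _), EReal.toReal_coe]

/-- Decay of the level sets of the maximal function on an interval, above its lower bound. -/
theorem volume_lt_hlMaximal_inter_Icc_le {g : ℝ → ℝ} {a b m : ℝ} (hab : a < b) (hm : 0 < m)
    (hg : ∀ c d, c ≤ a → b ≤ d →
      ∫⁻ x in Icc c d, ‖g x‖ₑ ≤ ENNReal.ofReal (m * (d - c))) {t : ℝ} (ht : 2 ≤ t) :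
    volume ({x | ENNReal.ofReal (t * m) < hlMaximal g x} ∩ Icc a b) ≤
      ENNReal.ofReal (15 / t * (b - a)) := by
  have ht0 : 0 < t := by linarith
  set E := {x | ENNReal.ofReal (t * m) < hlMaximal g x} ∩ Icc a b
  have hν : ∀ c d, volume.withDensity (fun x => ‖g x‖ₑ) (Icc c d) = ∫⁻ x in Icc c d, ‖g x‖ₑ :=
    fun c d => withDensity_apply _ measurableSet_Icc
  have key := mul_volume_le_of_forall_mem_closedBall (volume.withDensity fun x => ‖g x‖ₑ)
    (Icc (2 * a - b) (2 * b - a)) E (ENNReal.ofReal (t * m)) (b - a) (by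
      rintro x ⟨hx, hxI⟩
      simp only [hlMaximal, mem_ofPred_eq, lt_iSup_iff] at hx
      obtain ⟨c, d, hcd, hxcd, hlt⟩ := hx
      rw [setLAverage_eq, Real.volume_Icc, ENNReal.lt_div_iff_mul_lt (by simp [hcd]) (by simp)]
        at hlt
      -- If [c, d] were longer than [a, b], its hull with [a, b] would have length at most 2(d - c),
      -- forcing a mean at most 2m ≤ tm.
      have hlen : d - c ≤ b - a := by
        by_contra! hcon
        refine absurd hlt (not_lt.2 ?_)
        calc ∫⁻ y in Icc c d, ‖g y‖ₑ ≤ ∫⁻ y in Icc (min a c) (max b d), ‖g y‖ₑ :=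
              lintegral_mono_set (Icc_subset_Icc (min_le_right _ _) (le_max_right _ _))
          _ ≤ ENNReal.ofReal (m * (max b d - min a c)) :=
              hg _ _ (min_le_left _ _) (le_max_left _ _)
          _ ≤ ENNReal.ofReal (t * m * (d - c)) := by
              refine ENNReal.ofReal_le_ofReal ?_
              have h1 : max b d - min a c ≤ 2 * (d - c) := by
                rcases max_cases b d with h | h <;> rcases min_cases a c with h' | h' <;>
                  linarith [hxI.1, hxI.2, hxcd.1, hxcd.2]
              have h2 : 0 ≤ (t - 2) * (m * (d - c)) :=
                mul_nonneg (by linarith) (mul_nonneg hm.le (by linarith))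
              nlinarith
          _ = _ := ENNReal.ofReal_mul (by positivity)
      refine ⟨(c + d) / 2, (d - c) / 2, ?_⟩
      rw [← Real.Icc_eq_closedBall, hν, Real.volume_Icc]
      exact ⟨hxcd, by linarith, by linarith, Icc_subset_Icc (by linarith [hxI.1, hxcd.2])
        (by linarith [hxI.2, hxcd.1]), hlt.le⟩)
  rw [hν] at key
  have h5 : (5 : ℝ≥0∞) = ENNReal.ofReal 5 := by norm_num
  have key' : ENNReal.ofReal (t * m) * volume E ≤
      ENNReal.ofReal (t * m) * ENNReal.ofReal (15 / t * (b - a)) := by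
    calc _ ≤ _ := key
      _ ≤ 5 * ENNReal.ofReal (m * (2 * b - a - (2 * a - b))) := by
          gcongr
          exact hg _ _ (by linarith) (by linarith)
      _ = _ := by
          rw [h5, ← ENNReal.ofReal_mul (by norm_num), ← ENNReal.ofReal_mul (by positivity)]
          congr 1
          field_simp
          ring
  exact (ENNReal.mul_le_mul_iff_right (by simpa using mul_pos ht0 hm)
    ENNReal.ofReal_ne_top).1 key'

/-- At level t = eⁿ ≥ 2ⁿ the 1/t decay becomes geometric decay for y = log(Mg/m). Then y ≤ 3
exp(y/3) gives the constant 3(1 + 6 · 15) = 273. -/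
theorem lintegral_log_hlMaximal_sub_le {g : ℝ → ℝ} {a b m : ℝ} (hab : a < b) (hm : 0 < m)
    (hg : ∀ c d, c ≤ a → b ≤ d →
      ∫⁻ x in Icc c d, ‖g x‖ₑ ≤ ENNReal.ofReal (m * (d - c)))
    (hpos : ∀ x ∈ Icc a b, hlMaximal g x ≠ 0) :
    ∫⁻ x in Icc a b, ENNReal.ofReal (Real.log (hlMaximal g x).toReal - Real.log m) ≤
      ENNReal.ofReal (273 * (b - a)) := by
  set y : ℝ → ℝ := fun x => Real.log (hlMaximal g x).toReal - Real.log m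
  have hy : Measurable y := (measurable_hlMaximal g).ennreal_toReal.log.sub_const _
  have key := lintegral_exp_div_three_le (μ := volume.restrict (Icc a b)) hy.aemeasurable
    (ENNReal.ofReal (15 * (b - a))) (fun n => by
      rw [Measure.restrict_apply' measurableSet_Icc]
      -- The level n = 0 is separate because e⁰ < 2; there the measure of the whole interval
      -- suffices.
      rcases Nat.eq_zero_or_pos n with rfl | hn
      · rw [pow_zero, one_mul]
        refine (measure_mono inter_subset_right).trans ?_
        rw [Real.volume_Icc]
        exact ENNReal.ofReal_le_ofReal (by linarith)
      · have h2 : (2 : ℝ) ^ n ≤ Real.exp n := by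
          rw [← mul_one (n : ℝ), Real.exp_nat_mul]
          gcongr
          linarith [Real.exp_one_gt_d9]
        have h2' : (2 : ℝ) ≤ 2 ^ n := le_self_pow₀ (by norm_num) hn.ne'
        refine (measure_mono ?_).trans ((volume_lt_hlMaximal_inter_Icc_le hab hm hg
          (h2'.trans h2)).trans ?_)
        · rintro x ⟨hx, hxI⟩
          refine ⟨?_, hxI⟩
          have hx : (n : ℝ) < Real.log (hlMaximal g x).toReal - Real.log m := hx
          change ENNReal.ofReal (Real.exp n * m) < hlMaximal g x
          by_cases htop : hlMaximal g x = ∞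
          · rw [htop]
            exact ENNReal.ofReal_lt_top
          · rw [ENNReal.ofReal_lt_iff_lt_toReal (by positivity) htop]
            calc Real.exp n * m = Real.exp (n + Real.log m) := by
                  rw [Real.exp_add, Real.exp_log hm]
              _ < Real.exp (Real.log (hlMaximal g x).toReal) :=
                  Real.exp_lt_exp.2 (by linarith)
              _ = _ := Real.exp_log (ENNReal.toReal_pos (hpos x hxI) htop)
        · rw [show (2⁻¹ : ℝ≥0∞) = ENNReal.ofReal 2⁻¹ by
              rw [ENNReal.ofReal_inv_of_pos (by norm_num)]; norm_num,
            ← ENNReal.ofReal_pow (by norm_num), ← ENNReal.ofReal_mul (by positivity)]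
          refine ENNReal.ofReal_le_ofReal ?_
          have h3 : (Real.exp n)⁻¹ ≤ 2⁻¹ ^ n := by
            rw [inv_pow]
            exact inv_anti₀ (by positivity) h2
          calc 15 / Real.exp n * (b - a) = (Real.exp n)⁻¹ * (15 * (b - a)) := by ring
            _ ≤ _ := by gcongr)
  rw [Measure.restrict_apply_univ, Real.volume_Icc] at key
  calc ∫⁻ x in Icc a b, ENNReal.ofReal (y x)
      ≤ ∫⁻ x in Icc a b, 3 * ENNReal.ofReal (Real.exp (y x / 3)) := by
        refine lintegral_mono fun x => ?_
        rw [← ENNReal.ofReal_ofNat 3, ← ENNReal.ofReal_mul (by norm_num)]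
        refine ENNReal.ofReal_le_ofReal ?_
        linarith [Real.add_one_le_exp (y x / 3)]
    _ = 3 * ∫⁻ x in Icc a b, ENNReal.ofReal (Real.exp (y x / 3)) :=
        lintegral_const_mul' _ _ (by simp)
    _ ≤ 3 * (ENNReal.ofReal (b - a) + 6 * ENNReal.ofReal (15 * (b - a))) := by gcongr
    _ = _ := by
        rw [← ENNReal.ofReal_ofNat 3, ← ENNReal.ofReal_ofNat 6,
          ← ENNReal.ofReal_mul (by norm_num),
          ← ENNReal.ofReal_add (by linarith) (by linarith),
          ← ENNReal.ofReal_mul (by norm_num)]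
        congr 1
        ring

theorem IsLogMaximalDecomposition.ae_eq {f g b : ℝ → ℝ} {α : ℝ}
    (h : IsLogMaximalDecomposition f α g b) :
    ∀ᵐ x, hlMaximal g x ≠ 0 ∧ hlMaximal g x ≠ ∞ ∧
      f x = α * Real.log (hlMaximal g x).toReal + b x := by
  filter_upwards [h.2.2.2] with x hx
  have h0 : hlMaximal g x ≠ 0 := fun h0 => by
    rw [h0, ENNReal.log_zero, EReal.coe_mul_bot_of_pos h.1, EReal.bot_add] at hx
    exact EReal.coe_ne_bot _ hx
  have htop : hlMaximal g x ≠ ∞ := fun htop => by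
    rw [htop, ENNReal.log_top, EReal.coe_mul_top_of_pos h.1, EReal.top_add_coe] at hx
    exact EReal.coe_ne_top _ hx
  rw [ENNReal.log_pos_real h0 htop, ← EReal.coe_mul, ← EReal.coe_add] at hx
  exact ⟨h0, htop, EReal.coe_injective hx⟩

theorem bloNorm_le_of_decomposition {f g β : ℝ → ℝ} {α : ℝ} (hf : LocallyIntegrable f)
    (h : IsLogMaximalDecomposition f α g β) :
    bloNorm f ≤ 273 * (ENNReal.ofReal α + eLpNorm β ∞ volume) := by
  refine iSup_le fun a => iSup_le fun b => iSup_le fun hab => ?_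
  have hα := h.1
  have hae := h.ae_eq
  set B := (eLpNorm β ∞ volume).toReal with hB
  have hβ : ∀ᵐ x, |β x| ≤ B := by
    filter_upwards [ae_le_eLpNormEssSup (f := β) (μ := volume)] with x hx
    rw [← eLpNorm_exponent_top, Real.enorm_eq_ofReal_abs] at hx
    exact (ENNReal.ofReal_le_iff_le_toReal h.2.2.1.eLpNorm_ne_top).1 hx
  have hne : NeBot (ae (volume.restrict (Icc a b))) := by
    rw [ae_neBot, Ne, Measure.restrict_eq_zero, Real.volume_Icc]
    simpa using hab
  -- A pointwise infimum works because a mean over an interval containing [a, b] is at most Mg(x) at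
  -- every x in [a, b].
  set m₀ := ⨅ x ∈ Icc a b, hlMaximal g x
  have hm₀le : ∀ x ∈ Icc a b, m₀ ≤ hlMaximal g x := fun x hx => iInf₂_le x hx
  have havg : ∀ c d, c ≤ a → b ≤ d →
      ∫⁻ x in Icc c d, ‖g x‖ₑ ≤ m₀ * ENNReal.ofReal (d - c) := fun c d hc hd => by
    rw [← Real.volume_Icc, ← ENNReal.div_le_iff (by simp; linarith) (by simp), ← setLAverage_eq]
    exact le_iInf₂ fun x hx =>
      setLAverage_le_hlMaximal g (by linarith) (Icc_subset_Icc hc hd hx)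
  have hm₀top : m₀ ≠ ∞ := by
    obtain ⟨x, hx, hxI⟩ := ((ae_restrict_of_ae (s := Icc a b) hae).and
      (ae_restrict_mem measurableSet_Icc)).exists
    exact ne_top_of_le_ne_top hx.2.1 (hm₀le x hxI)
  -- If m₀ vanished, g would have zero integral on every interval containing [a, b], so Mg would
  -- vanish identically.
  have hm₀pos : m₀ ≠ 0 := fun h0 => by
    obtain ⟨x, hx⟩ := hae.exists
    refine hx.1 (le_antisymm ?_ bot_le)
    refine iSup_le fun c => iSup_le fun d => iSup_le fun _ => iSup_le fun _ => ?_
    have h1 := havg (min a c) (max b d) (min_le_left _ _) (le_max_left _ _)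
    rw [h0, zero_mul] at h1
    have h2 : ∫⁻ y in Icc c d, ‖g y‖ₑ ≤ 0 :=
      (lintegral_mono_set (Icc_subset_Icc (min_le_right _ _) (le_max_right _ _))).trans h1
    rw [setLAverage_eq, le_antisymm h2 bot_le, ENNReal.zero_div]
  set m := m₀.toReal
  have hm0 : 0 < m := ENNReal.toReal_pos hm₀pos hm₀top
  have hmm : m₀ = ENNReal.ofReal m := (ENNReal.ofReal_toReal hm₀top).symm
  have hlog := lintegral_log_hlMaximal_sub_le (g := g) hab hm0 (fun c d hc hd => by
    rw [ENNReal.ofReal_mul hm0.le, ← hmm]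
    exact havg c d hc hd)
    (fun x hx => ((pos_iff_ne_zero.2 hm₀pos).trans_le (hm₀le x hx)).ne')
  have hB0 : 0 ≤ B := ENNReal.toReal_nonneg
  have hfI : IntegrableOn f (Icc a b) := hf.integrableOn_isCompact isCompact_Icc
  -- The difference of the two constants is 273α + 2B, at most 273(α + B).
  refine (lowerOscillation_le (c := α * Real.log m - B) (C := α * Real.log m + B + 273 * α)
    hab ?_ ?_).trans ?_
  · filter_upwards [ae_restrict_of_ae hae, ae_restrict_of_ae hβ,
      ae_restrict_mem measurableSet_Icc] with x hx hβx hxI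
    have h1 : m ≤ (hlMaximal g x).toReal := ENNReal.toReal_mono hx.2.1 (hm₀le x hxI)
    have h2 := mul_le_mul_of_nonneg_left (Real.log_le_log hm0 h1) hα.le
    linarith [hx.2.2, (abs_le.1 hβx).1]
  · have h1 : ∫ x in Icc a b, (f x - (α * Real.log m + B)) ≤ α * (273 * (b - a)) := by
      have hint : Integrable (fun x => f x - (α * Real.log m + B)) (volume.restrict (Icc a b)) :=
        Integrable.sub hfI ((locallyIntegrable_const _).integrableOn_isCompact isCompact_Icc)
      rw [integral_eq_lintegral_pos_part_sub_lintegral_neg_part hint]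
      refine (sub_le_self _ ENNReal.toReal_nonneg).trans ?_
      refine ENNReal.toReal_le_of_le_ofReal (mul_nonneg hα.le (by linarith)) ?_
      calc ∫⁻ x in Icc a b, ENNReal.ofReal (f x - (α * Real.log m + B))
          ≤ ∫⁻ x in Icc a b, ENNReal.ofReal α *
              ENNReal.ofReal (Real.log (hlMaximal g x).toReal - Real.log m) := by
            refine lintegral_mono_ae ?_
            filter_upwards [ae_restrict_of_ae hae, ae_restrict_of_ae hβ] with x hx hβx
            rw [← ENNReal.ofReal_mul hα.le]
            refine ENNReal.ofReal_le_ofReal ?_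
            rw [hx.2.2]
            linarith [(abs_le.1 hβx).2]
        _ = ENNReal.ofReal α * ∫⁻ x in Icc a b,
              ENNReal.ofReal (Real.log (hlMaximal g x).toReal - Real.log m) :=
            lintegral_const_mul' _ _ ENNReal.ofReal_ne_top
        _ ≤ ENNReal.ofReal α * ENNReal.ofReal (273 * (b - a)) := by gcongr
        _ = _ := (ENNReal.ofReal_mul hα.le).symm
    rw [setIntegral_Icc_sub_const hf _ hab.le] at h1
    linarith
  · rw [← ENNReal.ofReal_toReal h.2.2.1.eLpNorm_ne_top, ← hB, ← ENNReal.ofReal_add hα.le hB0,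
      ← ENNReal.ofReal_ofNat 273, ← ENNReal.ofReal_mul (by norm_num)]
    refine ENNReal.ofReal_le_ofReal ?_
    linarith

/-! ### Conclusion. -/

theorem mainTheorem2 :
    ∃ d₁ d₂ : ℝ, 0 < d₁ ∧ 0 < d₂ ∧ ∀ f : ℝ → ℝ, IsBLO f →
      ENNReal.ofReal d₁ * bloNorm f ≤ bloNorm' f ∧
      bloNorm' f ≤ ENNReal.ofReal d₂ * bloNorm f := by
  refine ⟨273⁻¹, 900, by norm_num, by norm_num, fun f hf => ⟨?_, ?_⟩⟩
  · refine le_iInf fun α => le_iInf fun g => le_iInf fun β => le_iInf fun h => ?_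
    rw [ENNReal.ofReal_inv_of_pos (by norm_num), ENNReal.ofReal_ofNat, mul_comm, ← div_eq_mul_inv]
    exact ENNReal.div_le_of_le_mul' (bloNorm_le_of_decomposition hf.1 h)
  -- The upper bound needs N > 0, but the BLO norm may vanish, so N = ‖f‖ + ε with ε → 0.
  · have hlim : Tendsto (fun ε : ℝ => ENNReal.ofReal (900 * ((bloNorm f).toReal + ε))) (𝓝[>] 0)
        (𝓝 (ENNReal.ofReal 900 * bloNorm f)) := by
      have hc : Continuous fun ε : ℝ => ENNReal.ofReal (900 * ((bloNorm f).toReal + ε)) :=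
        ENNReal.continuous_ofReal.comp (by fun_prop)
      have := hc.tendsto 0
      rw [add_zero, ENNReal.ofReal_mul (by norm_num), ENNReal.ofReal_toReal hf.2.ne] at this
      exact tendsto_nhdsWithin_of_tendsto_nhds this
    refine ge_of_tendsto hlim ?_
    filter_upwards [self_mem_nhdsWithin] with ε (hε : 0 < ε)
    refine bloNorm'_le hf.1 (by positivity) ?_
    rw [ENNReal.le_ofReal_iff_toReal_le hf.2.ne (by positivity)]
    linarith
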